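/- Let $V$ be a finite-dimensional real Euclidean vector space and let $\mathcal A$ be a finite set of linear hyperplanes in $V$, each $H\in\mathcal A$ having a chosen nonzero normal vector $e_H$. The regions of $\mathcal A$ are the closures of the connected components of $V\setminus\bigcup_{H\in\mathcal A}H$; the faces of $\mathcal A$ are the intersections of nonempty sets of regions. A wall of a region $R$ is an $H\in\mathcal A$ with $\dim(H\cap R)=\dim V-1$. Assume that $\mathcal A$ is simplicial, that is, for every region the normal vectors of its walls are linearly independent. Fix a base region $B$. For regions $R,R'$ put $R\le_B R'$ if and only if every hyperplane of $\mathcal A$ that separates $B$ from $R$ also separates $B$ from $R'$. For a face $F$, the set of regions containing $F$ is an interval $[m_F,M_F]$ for $\le_B$, called the facial interval of $F$; in particular a region $R$, which is itself a face, has facial interval $[R,R]$. The facial weak order on the set of faces is defined by $F\le G$ if and only if $m_F\le_B m_G$ and $M_F\le_B M_G$. Then the regions ordered by $\le_B$ form a lattice, the faces ordered by the facial weak order form a lattice, and the lattice of regions is a sublattice of the facial weak order: for all regions $R,R'$ one has $R\le_B R'$ if and only if $R\le R'$ in the facial weak order, and the join and the meet of $R$ and $R'$ in the facial weak order are again regions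 and coincide with their join and meet in the lattice of regions. -/

import Mathlib

/-- A central hyperplane arrangement in a Euclidean space `V`: a finite set of linear hyperplanes,
with a fixed nonzero normal vector `normal H` for every hyperplane `H` of the arrangement. -/
structure CentralArrangement (V : Type*) [NormedAddCommGroup V] [InnerProductSpace ℝ V] where
  /-- the hyperplanes of the arrangement -/
  hyperplanes : Finset (Submodule ℝ V)
  /-- the chosen normal vectors (only the values on `hyperplanes` matter) -/
  normal : Submodule ℝ V → V
  normal_ne_zero : ∀ H ∈ hyperplanes, normal H ≠ 0
  mem_iff : ∀ H ∈ hyperplanes, ∀ v : V, v ∈ H ↔ inner ℝ (normal H) v = 0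

namespace CentralArrangement

variable {V : Type*} [NormedAddCommGroup V] [InnerProductSpace ℝ V]

/-- The complement in `V` of the union of all hyperplanes. -/
def complement (A : CentralArrangement V) : Set V :=
  {v | ∀ H ∈ A.hyperplanes, v ∉ H}

/-- A region is the closure of a connected component of the complement. -/
def IsRegion (A : CentralArrangement V) (R : Set V) : Prop :=
  ∃ x ∈ A.complement, R = closure (connectedComponentIn A.complement x)

/-- A face is an intersection of a (nonempty) set of regions. -/
def IsFace (A : CentralArrangement V) (F : Set V) : Prop :=
  ∃ S : Set (Set V), S.Nonempty ∧ (∀ R ∈ S, A.IsRegion R) ∧ F = ⋂₀ S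

/-- The walls of `R`: the hyperplanes `H` such that `H ∩ R` has dimension `dim V - 1`. The dimension
of the closed convex cone `H ∩ R` is the dimension of its linear span. -/
def walls (A : CentralArrangement V) (R : Set V) : Set (Submodule ℝ V) :=
  {H | H ∈ A.hyperplanes ∧
    Module.finrank ℝ (Submodule.span ℝ ((H : Set V) ∩ R)) + 1 = Module.finrank ℝ V}

/-- The arrangement is simplicial: the normal vectors of the walls of each region are linearly
independent. -/
def IsSimplicial (A : CentralArrangement V) : Prop :=
  ∀ R : Set V, A.IsRegion R → LinearIndepOn ℝ A.normal (A.walls R)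

/-- The hyperplane `H` separates `R` from `R'`: they lie on opposite sides of `H`. -/
def Separates (A : CentralArrangement V) (H : Submodule ℝ V) (R R' : Set V) : Prop :=
  ((∀ v ∈ R, 0 ≤ inner ℝ (A.normal H) v) ∧ (∀ v ∈ R', inner ℝ (A.normal H) v ≤ 0)) ∨
  ((∀ v ∈ R, inner ℝ (A.normal H) v ≤ 0) ∧ (∀ v ∈ R', 0 ≤ inner ℝ (A.normal H) v))

/-- The separation set of two regions. -/
def separationSet (A : CentralArrangement V) (R R' : Set V) : Set (Submodule ℝ V) :=
  {H | H ∈ A.hyperplanes ∧ A.Separates H R R'}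

/-- The type of regions of the arrangement (it carries no order by itself). -/
structure Region (A : CentralArrangement V) where
  /-- the underlying set -/
  carrier : Set V
  isRegion : A.IsRegion carrier

/-- The type of faces of the arrangement (it carries no order by itself). -/
structure Face (A : CentralArrangement V) where
  /-- the underlying set -/
  carrier : Set V
  isFace : A.IsFace carrier

/-- A region, seen as a face. -/
def Region.toFace {A : CentralArrangement V} (R : A.Region) : A.Face where
  carrier := R.carrier
  isFace := ⟨{R.carrier}, Set.singleton_nonempty _,
    fun _ h => (Set.mem_singleton_iff.1 h) ▸ R.isRegion, (Set.sInter_singleton _).symm⟩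

/-- The poset of regions with base region `B`: comparison of the separation sets with `B`. -/
def RegionLE {A : CentralArrangement V} (B R R' : A.Region) : Prop :=
  A.separationSet B.carrier R.carrier ⊆ A.separationSet B.carrier R'.carrier

/-- `[m, M]` is the facial interval of the face `F`: the regions that contain `F` are exactly those
between `m` and `M` in the poset of regions. -/
def IsFacialInterval {A : CentralArrangement V} (B : A.Region) (F : A.Face) (m M : A.Region) :
    Prop :=
  ∀ R : A.Region, F.carrier ⊆ R.carrier ↔ (RegionLE B m R ∧ RegionLE B R M)

/-- The facial weak order with base region `B`: `F ≤ G` if and only if `m_F ≤ m_G` and `M_F ≤ M_G`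
for the facial intervals `[m_F, M_F]` of `F` and `[m_G, M_G]` of `G`. -/
def FacialWeakLE {A : CentralArrangement V} (B : A.Region) (F G : A.Face) : Prop :=
  ∃ mF MF mG MG : A.Region, IsFacialInterval B F mF MF ∧ IsFacialInterval B G mG MG ∧
    RegionLE B mF mG ∧ RegionLE B MF MG

end CentralArrangement

/-!
Choose a point `b` in the base region and scale the linear form of each hyperplane so that it is
negative at `b`. A face is then determined by its covector, the sign vector of a point in its
relative interior, and the facial weak order becomes the componentwise order of covectors for
`-1 < 0 < 1` (`CentralArrangement.facialWeakLE_iff`): the ends of the facial interval of a face are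
obtained by replacing the zeros of its covector by `-1`, respectively by `1`. The regions are the
covectors without zeros, ordered in the same way.

It is therefore enough to find joins of covectors; meets follow by `v ↦ -v`. As the poset is finite
with a least element, only the joins of two elementary steps out of a common covector are needed
(`exists_isLUB_pair_of_step`). An elementary step from `z` goes up to a face of the cell of `z`, or
up to a cell of which `z` is a face, and every larger covector lies above such a step
(`exists_step`). Two steps to cofaces have their sum as join. Two steps to faces are faces of the
lowest chamber containing `z`, and their join is their intersection. For a step to a face `x` and a
step to a coface `y`, the join is a face of the highest chamber containing `x`. The last two cases
use that the chambers are simplicial: every form is, up to sign, a nonnegative combination of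
linearly independent walls (`isSimplicialAt_of_linearIndepOn`), so that any set of walls cuts out a
face, and the sign of a form on it can be read off from the walls.

Finally the ends of facial intervals give the greatest region below a face and the least region
above it, so a join or a meet of regions among the faces is a region. This yields at once the
lattice of regions and the sublattice property.
-/

/-! ### Joins from local joins -/

/-- The lemma of Björner, Edelman and Ziegler: in a poset without infinite ascending chains, it is
enough to have the joins of pairs of elementary steps out of a common element. -/
theorem exists_isLUB_pair_of_step {P : Type*} [PartialOrder P] [WellFoundedGT P]
    (step : P → P → Prop)
    (hstep : ∀ z x, z < x → ∃ y, step z y ∧ z < y ∧ y ≤ x)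
    (hjoin : ∀ z x y, step z x → step z y → ∃ t, IsLUB {x, y} t) (z : P) :
    ∀ x y, z ≤ x → z ≤ y → ∃ t, IsLUB {x, y} t := by
  induction z using WellFoundedGT.induction with
  | ind z ih =>
    intro x y hx hy
    rcases hx.eq_or_lt with rfl | hx
    · exact ⟨y, by simp [hy], fun u hu => hu (by simp)⟩
    rcases hy.eq_or_lt with rfl | hy
    · exact ⟨x, by simp [hx.le], fun u hu => hu (by simp)⟩
    obtain ⟨x₁, hsx, hzx, hx₁⟩ := hstep z x hx
    obtain ⟨y₁, hsy, hzy, hy₁⟩ := hstep z y hy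
    obtain ⟨w, hw, hw'⟩ := hjoin z x₁ y₁ hsx hsy
    obtain ⟨u, hu, hu'⟩ := ih x₁ hzx x w hx₁ (hw (by simp))
    obtain ⟨t, ht, ht'⟩ := ih y₁ hzy u y ((hw (by simp)).trans (hu (by simp))) hy₁
    have hut : u ≤ t := ht (by simp)
    have hxu : x ≤ u := hu (by simp)
    refine ⟨t, ?_, fun v hv => ?_⟩
    · simp only [upperBounds_insert, upperBounds_singleton, Set.mem_inter_iff, Set.mem_Ici]
      exact ⟨hxu.trans hut, ht (by simp)⟩
    · have hxv : x ≤ v := hv (by simp)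
      have hyv : y ≤ v := hv (by simp)
      have hwv : w ≤ v := hw' (by simp [hx₁.trans hxv, hy₁.trans hyv])
      have huv : u ≤ v := hu' (by simp [hxv, hwv])
      exact ht' (by simp [huv, hyv])

/-! ### Sign vectors of a finite family of linear forms -/

section Covectors

variable {ι V : Type*} [AddCommGroup V] [Module ℝ V]

/-- The sign vector (covector) of a point with respect to a family of linear forms. -/
noncomputable def signVector (f : ι → V →ₗ[ℝ] ℝ) (v : V) : ι → SignType :=
  fun i => SignType.sign (f i v)

/-- The closed cell of `p`: the points each of whose signs is zero or the sign of `p`. -/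
def closedCell (f : ι → V →ₗ[ℝ] ℝ) (p : V) : Set V :=
  {v | ∀ i, (f i p = 0 → f i v = 0) ∧ 0 ≤ f i p * f i v}

/-- The chamber of `r` is a simplicial cone: up to the sign of the values at `r`, all the forms are
nonnegative combinations of the forms indexed by `W`, which take arbitrary prescribed values.
Scaling every form by its value at `r` makes it positive at `r`, whence the factors `f i r`. -/
def IsSimplicialAt (f : ι → V →ₗ[ℝ] ℝ) (r : V) : Prop :=
  ∃ (W : Finset ι) (c : ι → ι → ℝ), (∀ i k, 0 ≤ c i k) ∧
    (∀ i v, f i r * f i v = ∑ k ∈ W, c i k * (f k r * f k v)) ∧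
    ∀ g : ι → ℝ, ∃ d, ∀ k ∈ W, f k d = g k

variable {f : ι → V →ₗ[ℝ] ℝ}

theorem sign_le_sign_iff {a b : ℝ} :
    SignType.sign a ≤ SignType.sign b ↔ (0 < a → 0 < b) ∧ (0 ≤ a → 0 ≤ b) := by
  rcases lt_trichotomy a 0 with ha | rfl | ha <;> rcases lt_trichotomy b 0 with hb | rfl | hb <;>
    simp [*, not_lt_of_gt, le_of_lt, not_le_of_gt]

theorem signVector_le_iff {x y : V} :
    signVector f x ≤ signVector f y ↔ ∀ i, (0 < f i x → 0 < f i y) ∧ (0 ≤ f i x → 0 ≤ f i y) :=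
  forall_congr' fun _ => sign_le_sign_iff

theorem signVector_neg_le_neg_iff {x y : V} :
    signVector f (-x) ≤ signVector f (-y) ↔ signVector f y ≤ signVector f x := by
  simp only [signVector_le_iff, map_neg]
  refine forall_congr' fun i => ?_
  grind

theorem mem_closedCell_iff {p v : V} :
    v ∈ closedCell f p ↔ ∀ i, (f i p = 0 → f i v = 0) ∧ (0 < f i p → 0 ≤ f i v) ∧
      (f i p < 0 → f i v ≤ 0) := by
  refine forall_congr' fun i => and_congr_right fun h => ?_
  rcases lt_trichotomy (f i p) 0 with hp | hp | hp
  · simp only [hp, hp.not_gt, false_imp_iff, true_imp_iff, true_and]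
    exact ⟨fun h => not_lt.1 fun hv => (mul_neg_of_neg_of_pos hp hv).not_ge h,
      mul_nonneg_of_nonpos_of_nonpos hp.le⟩
  · simp [hp]
  · simp [hp, not_lt_of_gt]

theorem mem_closedCell_congr {x x' y y' : V} (hx : signVector f x = signVector f x')
    (hy : signVector f y = signVector f y') : x ∈ closedCell f y ↔ x' ∈ closedCell f y' := by
  have h₁ := signVector_le_iff.1 hx.le
  have h₂ := signVector_le_iff.1 hx.ge
  have h₃ := signVector_le_iff.1 hy.le
  have h₄ := signVector_le_iff.1 hy.ge
  simp only [mem_closedCell_iff]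
  refine forall_congr' fun i => ?_
  have := h₁ i; have := h₂ i; have := h₃ i; have := h₄ i
  grind

/-- The composition of covectors: a small move from `z` in the direction `w` keeps the nonzero signs
of `z` and replaces its zeros by the signs of `w`. -/
theorem exists_perturbation [Finite ι] (f : ι → V →ₗ[ℝ] ℝ) (z w : V) :
    ∃ ε : ℝ, 0 < ε ∧ ∀ i, (0 < f i z → 0 < f i (z + ε • w)) ∧
      (f i z < 0 → f i (z + ε • w) < 0) ∧ (f i z = 0 → f i (z + ε • w) = ε * f i w) := by
  have key : ∀ᶠ ε in nhdsWithin (0 : ℝ) (Set.Ioi 0), ∀ i, (0 < f i z → 0 < f i (z + ε • w)) ∧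
      (f i z < 0 → f i (z + ε • w) < 0) := by
    rw [Filter.eventually_all]
    intro i
    have hc : Filter.Tendsto (fun ε : ℝ => f i (z + ε • w)) (nhdsWithin 0 (Set.Ioi 0))
        (nhds (f i z)) := by
      have : Continuous fun ε : ℝ => f i (z + ε • w) := by
        simp only [map_add, map_smul, smul_eq_mul]; fun_prop
      simpa using (this.tendsto 0).mono_left nhdsWithin_le_nhds
    rcases lt_trichotomy (f i z) 0 with h | h | h
    · filter_upwards [hc.eventually_lt_const h] with ε hε
      exact ⟨fun h' => absurd h' h.not_gt, fun _ => hε⟩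
    · simp [h]
    · filter_upwards [hc.eventually_const_lt h] with ε hε
      exact ⟨fun _ => hε, fun h' => absurd h' h.not_gt⟩
  obtain ⟨ε, hε, hpos⟩ := (key.and self_mem_nhdsWithin).exists
  exact ⟨ε, hpos, fun i => ⟨(hε i).1, (hε i).2, fun h => by simp [h]⟩⟩

/-- The lowest chamber containing `z`, when `b` is the bottom covector. -/
theorem exists_lower_chamber [Finite ι] {b : V} (hb : ∀ i, f i b < 0) (z : V) :
    ∃ r, ∀ i, (0 < f i z → 0 < f i r) ∧ (f i z ≤ 0 → f i r < 0) := by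
  obtain ⟨ε, hε, hr⟩ := exists_perturbation f z b
  refine ⟨z + ε • b, fun i => ?_⟩
  have := hr i; have := mul_neg_of_pos_of_neg hε (hb i); grind

/-- The highest chamber containing `z`, when `b` is the bottom covector. -/
theorem exists_upper_chamber [Finite ι] {b : V} (hb : ∀ i, f i b < 0) (z : V) :
    ∃ r, ∀ i, (0 ≤ f i z → 0 < f i r) ∧ (f i z < 0 → f i r < 0) := by
  obtain ⟨r, hr⟩ := exists_lower_chamber hb (-z)
  refine ⟨-r, fun i => ?_⟩
  have := hr i
  simp only [map_neg] at this ⊢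
  grind

/-- Below a larger covector there is an elementary step: towards a coface if some zero has to
become positive, and otherwise to the face met first by the segment. -/
theorem exists_step [Finite ι] {z x : V} (hzx : signVector f z < signVector f x) :
    ∃ y, (y ∈ closedCell f z ∨ z ∈ closedCell f y) ∧ signVector f z < signVector f y ∧
      signVector f y ≤ signVector f x := by
  obtain ⟨hle, hnot⟩ := lt_iff_le_not_ge.1 hzx
  have hle' := signVector_le_iff.1 hle
  by_cases h0 : ∃ i, f i z = 0 ∧ 0 < f i x
  · obtain ⟨i₀, hz₀, hx₀⟩ := h0
    obtain ⟨ε, hε, h⟩ := exists_perturbation f z x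
    have hmul (i) : (0 < ε * f i x ↔ 0 < f i x) ∧ (0 ≤ ε * f i x ↔ 0 ≤ f i x) :=
      ⟨mul_pos_iff_of_pos_left hε, mul_nonneg_iff_of_pos_left hε⟩
    refine ⟨z + ε • x, Or.inr (mem_closedCell_iff.2 fun i => ?_), lt_iff_le_not_ge.2
      ⟨signVector_le_iff.2 fun i => ?_, fun hc => ?_⟩, signVector_le_iff.2 fun i => ?_⟩
    · have := h i; grind
    · have := h i; have := hmul i; have := hle' i; grind
    · have := signVector_le_iff.1 hc i₀; have := h i₀; have := hmul i₀; grind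
    · have := h i; have := hmul i; have := hle' i; grind
  · push Not at h0
    cases nonempty_fintype ι
    classical
    have hne : (Finset.univ.filter fun i => f i z < 0 ∧ 0 ≤ f i x).Nonempty := by
      by_contra hcon
      rw [Finset.not_nonempty_iff_eq_empty, Finset.filter_eq_empty_iff] at hcon
      refine hnot (signVector_le_iff.2 fun i => ?_)
      have := hcon (Finset.mem_univ i); have := h0 i; have := hle' i
      grind
    -- the parameter at which the segment from `z` to `x` meets the kernel of the form `i`
    obtain ⟨i₀, hi₀, hmin⟩ := Finset.exists_min_image _
      (fun i => f i z / (f i z - f i x)) hne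
    simp only [Finset.mem_filter, Finset.mem_univ, true_and] at hi₀ hmin
    set t := f i₀ z / (f i₀ z - f i₀ x) with ht
    have ht0 : 0 < t := div_pos_of_neg_of_neg hi₀.1 (by linarith)
    have ht1 : t ≤ 1 := by
      rw [ht, div_le_one_of_neg (by linarith)]; linarith
    have hy (i) : f i (z + t • (x - z)) = (1 - t) * f i z + t * f i x := by
      simp only [map_add, map_smul, map_sub, smul_eq_mul]; ring
    have hy₀ : f i₀ (z + t • (x - z)) = 0 := by
      have : f i₀ z - f i₀ x ≠ 0 := by linarith [hi₀.1, hi₀.2]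
      rw [hy, ht]; field_simp; ring
    have hzero (i) (hi : f i z = 0) : f i (z + t • (x - z)) = 0 := by
      have : f i x = 0 := le_antisymm (h0 i hi) ((hle' i).2 hi.ge)
      rw [hy, hi, this]; ring
    have hpos (i) (hi : 0 < f i z) : 0 < f i (z + t • (x - z)) := by
      rw [hy]; have := (hle' i).1 hi
      have := mul_pos ht0 this
      have := mul_nonneg (sub_nonneg.2 ht1) hi.le
      linarith
    have hneg (i) (hi : f i z < 0) (hx : f i x < 0) : f i (z + t • (x - z)) < 0 := by
      rw [hy]
      have := mul_neg_of_pos_of_neg ht0 hx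
      have := mul_nonpos_of_nonneg_of_nonpos (sub_nonneg.2 ht1) hi.le
      linarith
    have hnonpos (i) (hi : f i z < 0) : f i (z + t • (x - z)) ≤ 0 := by
      by_cases hx : f i x < 0
      · exact (hneg i hi hx).le
      · have hd : f i z - f i x < 0 := by linarith
        have := hmin i ⟨hi, not_lt.1 hx⟩
        rw [le_div_iff_of_neg hd] at this
        rw [hy]; linarith
    refine ⟨z + t • (x - z), Or.inl (mem_closedCell_iff.2 fun i => ⟨hzero i, fun h => (hpos i h).le,
      hnonpos i⟩), lt_iff_le_not_ge.2 ⟨signVector_le_iff.2 fun i => ?_, fun hc => ?_⟩,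
      signVector_le_iff.2 fun i => ?_⟩
    · have := hzero i; have := hpos i; grind
    · have := signVector_le_iff.1 hc i₀; grind
    · have := hzero i; have := hpos i; have := hneg i; have := hnonpos i; have := hle' i; grind

/-- Any set `D` of walls of a simplicial chamber cuts out a face, the cell of `t`: the forms combined
from walls in `D` vanish at `t`, and the others have the same sign at `t` as on the chamber. -/
theorem exists_point_of_walls {r : V} {W : Finset ι} {c : ι → ι → ℝ} (hr : ∀ i, f i r ≠ 0)
    (hc : ∀ i k, 0 ≤ c i k)
    (hsum : ∀ i v, f i r * f i v = ∑ k ∈ W, c i k * (f k r * f k v))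
    (hdual : ∀ g : ι → ℝ, ∃ d, ∀ k ∈ W, f k d = g k) (D : ι → Prop) :
    ∃ t, ∀ i, ((∀ k ∈ W, c i k ≠ 0 → D k) → f i t = 0) ∧
      ((∃ k ∈ W, c i k ≠ 0 ∧ ¬ D k) → 0 < f i r * f i t) := by
  classical
  obtain ⟨t, ht⟩ := hdual fun k => if D k then 0 else f k r
  refine ⟨t, fun i => ⟨fun h => ?_, fun ⟨k, hk, hck, hDk⟩ => ?_⟩⟩
  · refine (mul_eq_zero.1 ?_).resolve_left (hr i)
    rw [hsum]
    refine Finset.sum_eq_zero fun k hk => ?_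
    by_cases hck : c i k = 0
    · simp [hck]
    · simp [ht k hk, h k hk hck]
  · rw [hsum]
    refine Finset.sum_pos' (fun j hj => mul_nonneg (hc i j) ?_) ⟨k, hk, ?_⟩
    · rw [ht j hj]; split_ifs
      · simp
      · exact mul_self_nonneg _
    · rw [ht k hk, if_neg hDk]
      exact mul_pos (lt_of_le_of_ne (hc i k) hck.symm) (mul_self_pos.2 (hr k))

/-- A form vanishing at a point `x` of a chamber is combined from walls through `x` only, since a sum
of nonnegative terms vanishes only if every term does. -/
theorem eq_zero_of_coeff_ne_zero {r x : V} {W : Finset ι} {c : ι → ι → ℝ}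
    (hc : ∀ i k, 0 ≤ c i k)
    (hsum : ∀ i v, f i r * f i v = ∑ k ∈ W, c i k * (f k r * f k v)) (hr : ∀ i, f i r ≠ 0)
    (hx : ∀ k, 0 ≤ f k r * f k x) {i : ι} (hi : f i x = 0) :
    ∀ k ∈ W, c i k ≠ 0 → f k x = 0 := by
  intro k hk hck
  have h := hsum i x
  rw [hi, mul_zero, eq_comm, Finset.sum_eq_zero_iff_of_nonneg
    fun j _ => mul_nonneg (hc i j) (hx j)] at h
  have := h k hk
  simpa [hck, hr k] using this

/-- Two steps to cofaces: the join is the sum, without any hypothesis on the family. -/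
theorem exists_join_of_cofaces {z x y : V} (hzx : signVector f z ≤ signVector f x)
    (hx : z ∈ closedCell f x) (hzy : signVector f z ≤ signVector f y) (hy : z ∈ closedCell f y) :
    ∃ t, signVector f x ≤ signVector f t ∧ signVector f y ≤ signVector f t ∧
      ∀ u, signVector f x ≤ signVector f u → signVector f y ≤ signVector f u →
        signVector f t ≤ signVector f u := by
  rw [mem_closedCell_iff] at hx hy
  rw [signVector_le_iff] at hzx hzy
  simp only [signVector_le_iff]
  refine ⟨x + y, fun i => ?_, fun i => ?_, fun u hxu hyu i => ?_⟩ <;>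
  rw [map_add] <;>
  have h₁ := hx i <;> have h₂ := hy i <;> have h₃ := hzx i <;> have h₄ := hzy i
  · constructor <;> intro <;> grind
  · constructor <;> intro <;> grind
  · have h₅ := hxu i; have h₆ := hyu i
    constructor <;> intro <;> grind

/-- Two steps to faces: both are faces of the lowest chamber containing `z`, and the join is their
intersection. -/
theorem exists_join_of_faces [Finite ι] {b : V} (hb : ∀ i, f i b < 0)
    (hs : ∀ r, (∀ i, f i r ≠ 0) → IsSimplicialAt f r) {z x y : V}
    (hzx : signVector f z ≤ signVector f x)
    (hx : x ∈ closedCell f z) (hzy : signVector f z ≤ signVector f y) (hy : y ∈ closedCell f z) :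
    ∃ t, signVector f x ≤ signVector f t ∧ signVector f y ≤ signVector f t ∧
      ∀ u, signVector f x ≤ signVector f u → signVector f y ≤ signVector f u →
        signVector f t ≤ signVector f u := by
  rw [mem_closedCell_iff] at hx hy
  rw [signVector_le_iff] at hzx hzy
  simp only [signVector_le_iff]
  obtain ⟨r, hr'⟩ := exists_lower_chamber hb z
  have hr0 (i) : f i r ≠ 0 := by have := hr' i; grind
  obtain ⟨W, c, hc, hsum, hdual⟩ := hs r hr0
  obtain ⟨t, ht⟩ := exists_point_of_walls hr0 hc hsum hdual fun k => f k x = 0 ∨ f k y = 0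
  have hrx (k) : 0 ≤ f k r * f k x := by
    rcases le_or_gt (f k z) 0 with h | h
    · exact mul_nonneg_of_nonpos_of_nonpos ((hr' k).2 h).le (by have := hx k; grind)
    · exact mul_nonneg ((hr' k).1 h).le (by have := hx k; grind)
  have hry (k) : 0 ≤ f k r * f k y := by
    rcases le_or_gt (f k z) 0 with h | h
    · exact mul_nonneg_of_nonpos_of_nonpos ((hr' k).2 h).le (by have := hy k; grind)
    · exact mul_nonneg ((hr' k).1 h).le (by have := hy k; grind)
  have hDneg (k) (h : f k x = 0 ∨ f k y = 0) : f k r < 0 := by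
    refine (hr' k).2 (not_lt.1 fun hz => ?_)
    have := (hzx k).1 hz; have := (hzy k).1 hz; grind
  -- a form combined from walls through `x` or `y` has the sign of `b` on the chamber
  have hneg (i) (h : ∀ k ∈ W, c i k ≠ 0 → (f k x = 0 ∨ f k y = 0)) : f i r < 0 := by
    have : 0 ≤ f i r * f i b := by
      rw [hsum]
      refine Finset.sum_nonneg fun k hk => ?_
      by_cases hck : c i k = 0
      · simp [hck]
      · exact mul_nonneg (hc i k) (mul_nonneg_of_nonpos_of_nonpos
          (hDneg k (h k hk hck)).le (hb k).le)
    refine lt_of_le_of_ne (not_lt.1 fun hp => ?_) (hr0 i)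
    exact absurd (mul_neg_of_pos_of_neg hp (hb i)) this.not_gt
  have hcases (i) : (∀ k ∈ W, c i k ≠ 0 → (f k x = 0 ∨ f k y = 0)) ∨
      ∃ k ∈ W, c i k ≠ 0 ∧ ¬ (f k x = 0 ∨ f k y = 0) := by
    by_contra! h
    obtain ⟨⟨k, hk, hck, h'⟩, h⟩ := h
    have := h k hk hck; grind
  have htpos (i) (hi : 0 < f i z) : 0 < f i t := by
    have h := (hr' i).1 hi
    rcases hcases i with h' | h'
    · exact absurd (hneg i h') h.not_gt
    · exact (mul_pos_iff_of_pos_left h).1 ((ht i).2 h')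
  have hle (w : V) (hw : w ∈ closedCell f z)
      (hw' : ∀ i, f i w = 0 → f i t = 0) (i : ι) :
      (0 < f i w → 0 < f i t) ∧ (0 ≤ f i w → 0 ≤ f i t) := by
    have := mem_closedCell_iff.1 hw i; have := hw' i; have := htpos i; grind
  refine ⟨t, hle x (mem_closedCell_iff.2 hx) fun i hi => (ht i).1 fun k hk hck =>
      Or.inl (eq_zero_of_coeff_ne_zero hc hsum hr0 hrx hi k hk hck),
    hle y (mem_closedCell_iff.2 hy) fun i hi => (ht i).1 fun k hk hck =>
      Or.inr (eq_zero_of_coeff_ne_zero hc hsum hr0 hry hi k hk hck), fun u hxu hyu i => ?_⟩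
  have hup (hi : 0 < f i z) : 0 < f i u := (hxu i).1 ((hzx i).1 hi)
  rcases hcases i with h | h
  · have h0 := (ht i).1 h
    have hri := hneg i h
    have : f i r * f i u ≤ 0 := by
      rw [hsum]
      refine Finset.sum_nonpos fun k hk => ?_
      by_cases hck : c i k = 0
      · simp [hck]
      · refine mul_nonpos_of_nonneg_of_nonpos (hc i k) (mul_nonpos_of_nonpos_of_nonneg
          (hDneg k (h k hk hck)).le ?_)
        rcases h k hk hck with h' | h'
        · exact (hxu k).2 h'.ge
        · exact (hyu k).2 h'.ge
    have : 0 ≤ f i u := by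
      by_contra! hu
      exact absurd (mul_pos_of_neg_of_neg hri hu) this.not_gt
    exact ⟨fun h' => absurd h' h0.le.not_gt, fun _ => this⟩
  · have h0 := (ht i).2 h
    rcases le_or_gt (f i z) 0 with hz | hz
    · have := neg_of_mul_pos_right h0 ((hr' i).2 hz).le
      exact ⟨fun h' => absurd h' this.not_gt, fun h' => absurd this h'.not_gt⟩
    · have := hup hz
      exact ⟨fun _ => this, fun _ => this.le⟩

/-- A step to a face `x` and a step to a coface `y`: the join is the face of the highest chamber
containing `x` cut out by those of its walls through `x` on which `y` is not positive. -/
theorem exists_join_of_face_of_coface [Finite ι] {b : V} (hb : ∀ i, f i b < 0)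
    (hs : ∀ r, (∀ i, f i r ≠ 0) → IsSimplicialAt f r) {z x y : V}
    (hzx : signVector f z ≤ signVector f x)
    (hx : x ∈ closedCell f z) (hy : z ∈ closedCell f y) :
    ∃ t, signVector f x ≤ signVector f t ∧ signVector f y ≤ signVector f t ∧
      ∀ u, signVector f x ≤ signVector f u → signVector f y ≤ signVector f u →
        signVector f t ≤ signVector f u := by
  rw [mem_closedCell_iff] at hx hy
  rw [signVector_le_iff] at hzx
  simp only [signVector_le_iff]
  obtain ⟨r, hr'⟩ := exists_upper_chamber hb x
  have hr0 (i) : f i r ≠ 0 := by have := hr' i; grind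
  obtain ⟨W, c, hc, hsum, hdual⟩ := hs r hr0
  obtain ⟨t, ht⟩ := exists_point_of_walls hr0 hc hsum hdual fun k => f k x = 0 ∧ f k y ≤ 0
  have hrx (k) : 0 ≤ f k r * f k x := by
    rcases le_or_gt 0 (f k x) with h | h
    · exact mul_nonneg ((hr' k).1 h).le h
    · exact mul_nonneg_of_nonpos_of_nonpos ((hr' k).2 h).le h.le
  have hcases (i) : (∀ k ∈ W, c i k ≠ 0 → (f k x = 0 ∧ f k y ≤ 0)) ∨
      ∃ k ∈ W, c i k ≠ 0 ∧ ¬ (f k x = 0 ∧ f k y ≤ 0) := by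
    by_contra! h
    obtain ⟨⟨k, hk, hck, h'⟩, h⟩ := h
    have := h k hk hck; grind
  have hD (i) (h : ∀ k ∈ W, c i k ≠ 0 → (f k x = 0 ∧ f k y ≤ 0)) :
      f i x = 0 ∧ f i y ≤ 0 := by
    have h0 : f i x = 0 := by
      refine (mul_eq_zero.1 ?_).resolve_left (hr0 i)
      rw [hsum]
      refine Finset.sum_eq_zero fun k hk => ?_
      by_cases hck : c i k = 0
      · simp [hck]
      · simp [(h k hk hck).1]
    refine ⟨h0, not_lt.1 fun hp => ?_⟩
    have := mul_pos ((hr' i).1 h0.ge) hp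
    rw [hsum] at this
    refine absurd this (Finset.sum_nonpos fun k hk => ?_).not_gt
    by_cases hck : c i k = 0
    · simp [hck]
    · obtain ⟨h₁, h₂⟩ := h k hk hck
      exact mul_nonpos_of_nonneg_of_nonpos (hc i k)
        (mul_nonpos_of_nonneg_of_nonpos ((hr' k).1 h₁.ge).le h₂)
  -- the sign of `t` on every form
  have ht' (i) : (f i x < 0 → f i t < 0) ∧ (0 < f i x → 0 < f i t) ∧ (f i x = 0 → 0 ≤ f i t) ∧
      (f i x = 0 → 0 < f i y → 0 < f i t) := by
    rcases hcases i with h | h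
    · have := (ht i).1 h; have := hD i h; grind
    · have h0 := (ht i).2 h
      rcases le_or_gt 0 (f i x) with hx' | hx'
      · have := (mul_pos_iff_of_pos_left ((hr' i).1 hx')).1 h0
        grind
      · have := neg_of_mul_pos_right h0 ((hr' i).2 hx').le
        grind
  refine ⟨t, fun i => ?_, fun i => ?_, fun u hxu hyu i => ?_⟩
  · have := ht' i; grind
  · have := ht' i; have := hx i; have := hy i; have := hzx i; grind
  · have h₁ := ht' i
    have h₂ := hxu i
    rcases hcases i with h | h
    · have := (ht i).1 h; have := hD i h; grind
    · rcases lt_trichotomy (f i x) 0 with hx' | hx' | hx'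
      · grind
      · have hsupp := eq_zero_of_coeff_ne_zero hc hsum hr0 hrx hx'
        have hru : 0 < f i r * f i u := by
          rw [hsum]
          refine Finset.sum_pos' (fun k hk => ?_) ?_
          · by_cases hck : c i k = 0
            · simp [hck]
            · have := hsupp k hk hck
              exact mul_nonneg (hc i k) (mul_nonneg ((hr' k).1 this.ge).le ((hxu k).2 this.ge))
          · obtain ⟨k, hk, hck, hnD⟩ := h
            have := hsupp k hk hck
            refine ⟨k, hk, mul_pos (lt_of_le_of_ne (hc i k) hck.symm)
              (mul_pos ((hr' k).1 this.ge) ((hyu k).1 ?_))⟩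
            grind
        have := (mul_pos_iff_of_pos_left ((hr' i).1 hx'.ge)).1 hru
        grind
      · grind

/-- Covectors of a simplicial family have joins. -/
theorem exists_join [Finite ι] {b : V} (hb : ∀ i, f i b < 0)
    (hs : ∀ r, (∀ i, f i r ≠ 0) → IsSimplicialAt f r) (x y : V) :
    ∃ t, signVector f x ≤ signVector f t ∧ signVector f y ≤ signVector f t ∧
      ∀ u, signVector f x ≤ signVector f u → signVector f y ≤ signVector f u →
        signVector f t ≤ signVector f u := by
  have hbot (v : V) : signVector f b ≤ signVector f v :=
    signVector_le_iff.2 fun i => by have := hb i; grind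
  have := exists_isLUB_pair_of_step (P := Set.range (signVector f))
    -- the face relation depends only on the covectors, so it may be asked for all their points
    (fun Z Y => Z ≤ Y ∧ ∀ z y : V, signVector f z = Z → signVector f y = Y →
      (y ∈ closedCell f z ∨ z ∈ closedCell f y)) ?_ ?_ ⟨_, b, rfl⟩ ⟨_, x, rfl⟩ ⟨_, y, rfl⟩
      (hbot x) (hbot y)
  · obtain ⟨⟨_, t, rfl⟩, ht, ht'⟩ := this
    refine ⟨t, ht (Set.mem_insert _ _), ht (Set.mem_insert_of_mem _ rfl), fun u hxu hyu => ?_⟩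
    exact @ht' ⟨_, u, rfl⟩ (by simpa using ⟨hxu, hyu⟩)
  · rintro ⟨_, z, rfl⟩ ⟨_, x, rfl⟩ hzx
    obtain ⟨y, hy, hzy, hyx⟩ := exists_step (f := f) (z := z) (x := x) hzx
    refine ⟨⟨_, y, rfl⟩, ⟨hzy.le, fun z' y' hz' hy' => ?_⟩, hzy, hyx⟩
    rwa [mem_closedCell_congr hy' hz', mem_closedCell_congr hz' hy']
  · rintro ⟨_, z, rfl⟩ ⟨_, x, rfl⟩ ⟨_, y, rfl⟩ ⟨hzx, hx⟩ ⟨hzy, hy⟩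
    replace hx := hx z x rfl rfl
    replace hy := hy z y rfl rfl
    suffices h : ∃ t, signVector f x ≤ signVector f t ∧ signVector f y ≤ signVector f t ∧
      ∀ u, signVector f x ≤ signVector f u → signVector f y ≤ signVector f u →
        signVector f t ≤ signVector f u by
      obtain ⟨t, h₁, h₂, h₃⟩ := h
      refine ⟨⟨_, t, rfl⟩, by simpa using ⟨h₁, h₂⟩, ?_⟩
      rintro ⟨_, u, rfl⟩ hu
      exact h₃ u (hu (Set.mem_insert _ _)) (hu (Set.mem_insert_of_mem _ rfl))
    rcases hx with hx | hx <;> rcases hy with hy | hy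
    · exact exists_join_of_faces hb hs hzx hx hzy hy
    · exact exists_join_of_face_of_coface hb hs hzx hx hy
    · obtain ⟨t, h₁, h₂, h₃⟩ := exists_join_of_face_of_coface hb hs hzy hy hx
      exact ⟨t, h₂, h₁, fun u hx hy => h₃ u hy hx⟩
    · exact exists_join_of_cofaces hzx hx hzy hy

/-- Meets follow from joins, because `v ↦ -v` reverses the order of the covectors. -/
theorem exists_meet [Finite ι] {b : V} (hb : ∀ i, f i b < 0)
    (hs : ∀ r, (∀ i, f i r ≠ 0) → IsSimplicialAt f r) (x y : V) :
    ∃ t, signVector f t ≤ signVector f x ∧ signVector f t ≤ signVector f y ∧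
      ∀ u, signVector f u ≤ signVector f x → signVector f u ≤ signVector f y →
        signVector f u ≤ signVector f t := by
  obtain ⟨t, h₁, h₂, h₃⟩ := exists_join hb hs (-x) (-y)
  refine ⟨-t, ?_, ?_, fun u hx hy => ?_⟩
  · rwa [← signVector_neg_le_neg_iff, neg_neg]
  · rwa [← signVector_neg_le_neg_iff, neg_neg]
  · rw [← signVector_neg_le_neg_iff, neg_neg]
    exact h₃ _ (signVector_neg_le_neg_iff.2 hx) (signVector_neg_le_neg_iff.2 hy)

end Covectors

/-! ### Cells and chambers of a family of linear forms -/

section Cells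

variable {ι V : Type*} [AddCommGroup V] [Module ℝ V] {f : ι → V →ₗ[ℝ] ℝ}

theorem mem_closedCell_self (p : V) : p ∈ closedCell f p :=
  fun i => ⟨id, mul_self_nonneg (f i p)⟩

theorem closedCell_subset_iff {p q : V} : closedCell f p ⊆ closedCell f q ↔ p ∈ closedCell f q := by
  refine ⟨fun h => h (mem_closedCell_self p), fun h v hv => ?_⟩
  rw [mem_closedCell_iff] at *
  intro i
  have := h i; have := hv i
  grind

theorem closedCell_eq_iff {p q : V} :
    closedCell f p = closedCell f q ↔ signVector f p = signVector f q := by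
  rw [Set.Subset.antisymm_iff, closedCell_subset_iff, closedCell_subset_iff, le_antisymm_iff,
    signVector_le_iff, signVector_le_iff, mem_closedCell_iff, mem_closedCell_iff]
  refine ⟨fun ⟨h₁, h₂⟩ => ⟨fun i => ?_, fun i => ?_⟩, fun ⟨h₁, h₂⟩ => ⟨fun i => ?_, fun i => ?_⟩⟩ <;>
  · have := h₁ i; have := h₂ i
    grind

/-- The intersection of a nonempty set of chambers is the cell of a relative interior point: the sum,
over all forms not vanishing on the intersection, of a point at which the form does not vanish. -/
theorem exists_closedCell_eq_iInter [Finite ι] {S : Set V} (hS : S.Nonempty)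
    (hgen : ∀ r ∈ S, ∀ i, f i r ≠ 0) : ∃ p, closedCell f p = ⋂ r ∈ S, closedCell f r := by
  cases nonempty_fintype ι
  set F := ⋂ r ∈ S, closedCell f r with hF
  have hmem {v : V} : v ∈ F ↔ ∀ r ∈ S, ∀ i, 0 ≤ f i r * f i v := by
    simp only [hF, Set.mem_iInter, closedCell, Set.mem_ofPred_eq]
    exact forall₂_congr fun r hr => forall_congr' fun i => by simp [hgen r hr i]
  have hpt (i) : ∃ v ∈ F, (f i v = 0 → ∀ w ∈ F, f i w = 0) := by
    by_cases h : ∃ v ∈ F, f i v ≠ 0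
    · obtain ⟨v, hv, hne⟩ := h
      exact ⟨v, hv, fun h' => absurd h' hne⟩
    · push Not at h
      exact ⟨0, hmem.2 (by simp), fun _ => h⟩
  choose w hwF hw using hpt
  obtain ⟨r₀, hr₀⟩ := hS
  have hpF : ∑ j, w j ∈ F := hmem.2 fun r hr i => by
    rw [map_sum, Finset.mul_sum]
    exact Finset.sum_nonneg fun j _ => hmem.1 (hwF j) r hr i
  refine ⟨∑ j, w j, Set.Subset.antisymm ?_ fun v hv i => ?_⟩
  · rw [hF]
    refine Set.subset_iInter₂ fun r hr => closedCell_subset_iff.2 ?_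
    exact Set.mem_iInter₂.1 (hF ▸ hpF) r hr
  · have h₁ := hmem.1 hpF r₀ hr₀ i
    have h₂ := hmem.1 hv r₀ hr₀ i
    refine ⟨fun h0 => hw i ?_ v hv, ?_⟩
    · have hsum : ∑ j, f i r₀ * f i (w j) = 0 := by
        rw [← Finset.mul_sum, ← map_sum, h0, mul_zero]
      have := (Finset.sum_eq_zero_iff_of_nonneg
        fun j _ => hmem.1 (hwF j) r₀ hr₀ i).1 hsum i (Finset.mem_univ i)
      exact (mul_eq_zero.1 this).resolve_left (hgen r₀ hr₀ i)
    · have h₃ : 0 ≤ (f i r₀ * f i r₀) * (f i (∑ j, w j) * f i v) := by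
        have := mul_nonneg h₁ h₂
        linarith
      exact (mul_nonneg_iff_of_pos_left (mul_self_pos.2 (hgen r₀ hr₀ i))).1 h₃

/-- A cell is the intersection of the chambers containing it; the lowest and the highest of them
suffice. -/
theorem closedCell_eq_iInter [Finite ι] {b : V} (hb : ∀ i, f i b < 0) (p : V) :
    closedCell f p = ⋂ r ∈ {r | (∀ i, f i r ≠ 0) ∧ p ∈ closedCell f r}, closedCell f r := by
  obtain ⟨m, hm⟩ := exists_lower_chamber hb p
  obtain ⟨M, hM⟩ := exists_upper_chamber hb p
  refine Set.Subset.antisymm (Set.subset_iInter₂ fun r hr => closedCell_subset_iff.2 hr.2) ?_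
  intro v hv
  rw [Set.mem_iInter₂] at hv
  have h₁ := mem_closedCell_iff.1 (hv m ⟨fun i => by have := hm i; grind,
    mem_closedCell_iff.2 fun i => by have := hm i; grind⟩)
  have h₂ := mem_closedCell_iff.1 (hv M ⟨fun i => by have := hM i; grind,
    mem_closedCell_iff.2 fun i => by have := hM i; grind⟩)
  rw [mem_closedCell_iff]
  intro i
  have := h₁ i; have := h₂ i; have := hm i; have := hM i
  grind

/-- The chambers containing `z` form an interval. -/
theorem mem_closedCell_iff_of_chamber {z m M r : V}
    (hm : ∀ i, (0 < f i z → 0 < f i m) ∧ (f i z ≤ 0 → f i m < 0))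
    (hM : ∀ i, (0 ≤ f i z → 0 < f i M) ∧ (f i z < 0 → f i M < 0)) (hr : ∀ i, f i r ≠ 0) :
    z ∈ closedCell f r ↔
      signVector f m ≤ signVector f r ∧ signVector f r ≤ signVector f M := by
  rw [signVector_le_iff, signVector_le_iff, mem_closedCell_iff]
  refine ⟨fun h => ⟨fun i => ?_, fun i => ?_⟩, fun ⟨h₁, h₂⟩ i => ?_⟩
  · have := h i; have := hm i; have := hr i; grind
  · have := h i; have := hM i; have := hr i; grind
  · have := h₁ i; have := h₂ i; have := hm i; have := hM i; have := hr i; grind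

/-- The covector order compares the lower ends and the upper ends of the intervals of chambers. -/
theorem signVector_le_iff_chambers {z m M z' m' M' : V}
    (hm : ∀ i, (0 < f i z → 0 < f i m) ∧ (f i z ≤ 0 → f i m < 0))
    (hM : ∀ i, (0 ≤ f i z → 0 < f i M) ∧ (f i z < 0 → f i M < 0))
    (hm' : ∀ i, (0 < f i z' → 0 < f i m') ∧ (f i z' ≤ 0 → f i m' < 0))
    (hM' : ∀ i, (0 ≤ f i z' → 0 < f i M') ∧ (f i z' < 0 → f i M' < 0)) :
    signVector f z ≤ signVector f z' ↔
      signVector f m ≤ signVector f m' ∧ signVector f M ≤ signVector f M' := by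
  simp only [signVector_le_iff, ← forall_and]
  refine forall_congr' fun i => ?_
  have := hm i; have := hM i; have := hm' i; have := hM' i
  grind

end Cells

section Topology

variable {ι V : Type*} [NormedAddCommGroup V] [NormedSpace ℝ V] [FiniteDimensional ℝ V]
  {f : ι → V →ₗ[ℝ] ℝ}

theorem connectedComponentIn_eq_of_forms {x : V} (hx : ∀ i, f i x ≠ 0) :
    connectedComponentIn {v | ∀ i, f i v ≠ 0} x = {v | ∀ i, 0 < f i x * f i v} := by
  have hxC : x ∈ {v | ∀ i, f i v ≠ 0} := hx
  refine Set.Subset.antisymm (fun v hv i => ?_) ?_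
  · by_contra! hle
    have hg : Continuous fun v => f i x * f i v :=
      continuous_const.mul (f i).continuous_of_finiteDimensional
    obtain ⟨u, hu, hu0⟩ := isPreconnected_connectedComponentIn.intermediate_value hv
      (mem_connectedComponentIn hxC) hg.continuousOn ⟨hle, mul_self_nonneg (f i x)⟩
    exact connectedComponentIn_subset _ _ hu i ((mul_eq_zero.1 hu0).resolve_left (hx i))
  · have hconv : Convex ℝ {v | ∀ i, 0 < f i x * f i v} := by
      rw [Set.ofPred_forall]
      refine convex_iInter fun i => ?_
      exact convex_halfSpace_gt (f := fun v => f i x * f i v)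
        ((f i x) • (f i)).isLinear 0
    exact hconv.isPreconnected.subset_connectedComponentIn (fun i => mul_self_pos.2 (hx i))
      fun v hv i h0 => by simpa [h0] using hv i

theorem closure_connectedComponentIn_eq_closedCell {x : V} (hx : ∀ i, f i x ≠ 0) :
    closure (connectedComponentIn {v | ∀ i, f i v ≠ 0} x) = closedCell f x := by
  rw [connectedComponentIn_eq_of_forms hx]
  have hcell : closedCell f x = {v | ∀ i, 0 ≤ f i x * f i v} := by
    ext v; exact forall_congr' fun i => by simp [hx i]
  rw [hcell]
  refine Set.Subset.antisymm (closure_minimal (fun v hv i => (hv i).le) ?_) fun v hv => ?_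
  · rw [Set.ofPred_forall]
    exact isClosed_iInter fun i => isClosed_le continuous_const
      (continuous_const.mul (f i).continuous_of_finiteDimensional)
  · have hc : Filter.Tendsto (fun ε : ℝ => v + ε • x) (nhdsWithin 0 (Set.Ioi 0)) (nhds v) := by
      have : Continuous fun ε : ℝ => v + ε • x := by fun_prop
      simpa using (this.tendsto 0).mono_left nhdsWithin_le_nhds
    refine mem_closure_of_tendsto hc (Filter.eventually_of_mem self_mem_nhdsWithin fun ε hε i => ?_)
    have h₁ := hv i
    have h₂ := mul_pos hε (mul_self_pos.2 (hx i))
    simp only [map_add, map_smul, smul_eq_mul]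
    linarith

end Topology

/-! ### Simplicial chambers -/

section Simplicial

variable {ι V : Type*} [AddCommGroup V] [Module ℝ V]

theorem exists_eq_of_linearIndependent {κ : Type*} [Finite κ] {g : κ → V →ₗ[ℝ] ℝ}
    (hg : LinearIndependent ℝ g) (a : κ → ℝ) : ∃ d, ∀ k, g k d = a k := by
  cases nonempty_fintype κ
  have hsurj : Function.Surjective (LinearMap.pi g) := by
    rw [← LinearMap.dualMap_injective_iff, injective_iff_map_eq_zero]
    intro φ hφ
    classical
    refine LinearMap.pi_ext' fun k => LinearMap.ext_ring ?_
    refine Fintype.linearIndependent_iff.1 hg (fun k => φ (Pi.single k 1)) ?_ k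
    ext v
    have := LinearMap.congr_fun hφ v
    rw [LinearMap.dualMap_apply, LinearMap.pi_apply_eq_sum_univ φ] at this
    have hsingle (k : κ) : (Pi.single k 1 : κ → ℝ) = fun j => if k = j then 1 else 0 := by
      ext j; simp [Pi.single_apply, eq_comm]
    simpa [mul_comm, LinearMap.sum_apply, hsingle] using this
  obtain ⟨d, hd⟩ := hsurj a
  exact ⟨d, fun k => congrFun hd k⟩

/-- Any minimal set of inequalities defining a chamber consists of walls. If the walls are linearly
independent, the points dual to such a set show that the other forms are nonnegative
combinations. -/
theorem isSimplicialAt_of_linearIndepOn [Finite ι] [FiniteDimensional ℝ V] {f : ι → V →ₗ[ℝ] ℝ}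
    {r : V}
    (hr : ∀ i, f i r ≠ 0)
    (h : LinearIndepOn ℝ f {k | Module.finrank ℝ
      (Submodule.span ℝ ((LinearMap.ker (f k) : Set V) ∩ closedCell f r)) + 1 =
        Module.finrank ℝ V}) : IsSimplicialAt f r := by
  classical
  cases nonempty_fintype ι
  obtain ⟨W, hW⟩ := exists_minimal_of_wellFoundedLT
    (fun W : Finset ι => ∀ v, (∀ k ∈ W, 0 ≤ f k r * f k v) → ∀ i, 0 ≤ f i r * f i v)
    ⟨Finset.univ, fun v hv i => hv i (Finset.mem_univ i)⟩
  have hwall : (W : Set ι) ⊆ {k | Module.finrank ℝ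
      (Submodule.span ℝ ((LinearMap.ker (f k) : Set V) ∩ closedCell f r)) + 1 =
        Module.finrank ℝ V} := by
    intro k hk
    rw [Finset.mem_coe] at hk
    have hnot := hW.not_prop_of_lt (Finset.erase_ssubset hk)
    push Not at hnot
    obtain ⟨v, hv, i, hi⟩ := hnot
    have hkv : f k r * f k v < 0 := by
      by_contra! hcon
      refine absurd (hW.prop v (fun j hj => ?_) i) hi.not_ge
      by_cases hjk : j = k
      · exact hjk ▸ hcon
      · exact hv j (Finset.mem_erase.2 ⟨hjk, hj⟩)
    -- the point where the segment from `v` to `r` crosses the kernel of `f k`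
    set u := (f k r * f k r) • v - (f k r * f k v) • r with hu
    have hku : f k u = 0 := by
      simp only [hu, map_sub, map_smul, smul_eq_mul]; ring
    have hju (j) (hj : j ∈ W) (hjk : j ≠ k) : 0 < f j r * f j u := by
      have h₁ := mul_nonneg (mul_self_nonneg (f k r)) (hv j (Finset.mem_erase.2 ⟨hjk, hj⟩))
      have h₂ := mul_neg_of_neg_of_pos hkv (mul_self_pos.2 (hr j))
      simp only [hu, map_sub, map_smul, smul_eq_mul]
      linarith
    have hcell {x : V} (hx : ∀ j ∈ W, 0 ≤ f j r * f j x) : x ∈ closedCell f r :=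
      fun i => ⟨fun h0 => absurd h0 (hr i), hW.prop x hx i⟩
    have huF : u ∈ closedCell f r := hcell fun j hj => by
      by_cases hjk : j = k
      · simp [hjk, hku]
      · exact (hju j hj hjk).le
    have hspan : Submodule.span ℝ ((LinearMap.ker (f k) : Set V) ∩ closedCell f r) =
        LinearMap.ker (f k) := by
      refine le_antisymm (Submodule.span_le.2 Set.inter_subset_left) fun w hw => ?_
      rw [LinearMap.mem_ker] at hw
      obtain ⟨ε, hε, hpert⟩ := exists_perturbation f u w
      have hmem : u + ε • w ∈ closedCell f r := hcell fun j hj => by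
        by_cases hjk : j = k
        · simp [hjk, hku, hw]
        · have hpos := hju j hj hjk
          have := hpert j
          rcases lt_or_gt_of_ne (hr j) with hj | hj
          · exact (mul_pos_of_neg_of_neg hj (this.2.1 (by
              have := neg_of_mul_pos_right hpos hj.le; exact this))).le
          · exact (mul_pos hj (this.1 ((mul_pos_iff_of_pos_left hj).1 hpos))).le
      have hwe : w = ε⁻¹ • ((u + ε • w) - u) := by
        rw [add_sub_cancel_left, smul_smul, inv_mul_cancel₀ hε.ne', one_smul]
      rw [hwe]
      exact Submodule.smul_mem _ _ (Submodule.sub_mem _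
        (Submodule.subset_span ⟨by simp [hku, hw], hmem⟩)
        (Submodule.subset_span ⟨by simp [hku], huF⟩))
    rw [Set.mem_ofPred_eq, hspan]
    exact Module.Dual.finrank_ker_add_one_of_ne_zero
      (f := f k) fun h0 => hr k (by rw [h0]; rfl)
  have hind : LinearIndependent ℝ fun k : W => f k := h.mono hwall
  have hdual (g : ι → ℝ) : ∃ d, ∀ k ∈ W, f k d = g k := by
    obtain ⟨d, hd⟩ := exists_eq_of_linearIndependent hind fun k => g k
    exact ⟨d, fun k hk => hd ⟨k, hk⟩⟩
  have hcomb (i) : ∃ c : ι → ℝ, (∀ k, 0 ≤ c k) ∧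
      ∀ v, f i r * f i v = ∑ k ∈ W, c k * (f k r * f k v) := by
    have hker : f i ∈ Submodule.span ℝ (Set.range fun k : W => f k) := by
      refine mem_span_of_iInf_ker_le_ker fun v hv => ?_
      simp only [Submodule.mem_iInf, LinearMap.mem_ker, Subtype.forall] at hv ⊢
      have h₁ := hW.prop v (fun k hk => by simp [hv k hk]) i
      have h₂ := hW.prop (-v) (fun k hk => by simp [hv k hk]) i
      rw [map_neg, mul_neg] at h₂
      exact (mul_eq_zero.1 (by linarith : f i r * f i v = 0)).resolve_left (hr i)
    obtain ⟨a, ha⟩ := (Submodule.mem_span_range_iff_exists_fun ℝ).1 hker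
    -- the coefficient of the wall `k` after scaling all the forms by their values at `r`
    let c : ι → ℝ := fun k => if hk : k ∈ W then f i r * a ⟨k, hk⟩ / f k r else 0
    have hc (v) : f i r * f i v = ∑ k ∈ W, c k * (f k r * f k v) := by
      have hv : f i v = ∑ k : W, a k * f k v := by
        rw [← ha, LinearMap.sum_apply]; rfl
      rw [hv, Finset.mul_sum, ← Finset.sum_coe_sort W]
      refine Finset.sum_congr rfl fun k _ => ?_
      have := hr k
      simp only [c, k.2, dif_pos]
      field_simp
    refine ⟨c, fun k => ?_, hc⟩
    by_cases hk : k ∈ W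
    · obtain ⟨d, hd⟩ := hdual fun j => if j = k then f k r else 0
      have hpos := hW.prop d (fun j hj => by
        rw [hd j hj]; split_ifs with hjk
        · exact hjk ▸ mul_self_nonneg _
        · simp) i
      rw [hc, Finset.sum_eq_single k (fun j hj hjk => by simp [hd j hj, hjk])
        fun h => absurd hk h, hd k hk, if_pos rfl] at hpos
      exact (mul_nonneg_iff_of_pos_right (mul_self_pos.2 (hr k))).1 hpos
    · simp [c, hk]
  choose c hc hsum using hcomb
  exact ⟨W, c, hc, hsum, hdual⟩

end Simplicial

/-! ### Arrangements and the facial weak order -/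

/-- A partial order embedded in another one is a lattice if joins and meets exist in the image. -/
theorem exists_lattice_of_join_meet {α β : Type*} [PartialOrder β] {s : α → β}
    (hs : Function.Injective s)
    (hjoin : ∀ x y, ∃ t, s x ≤ s t ∧ s y ≤ s t ∧ ∀ u, s x ≤ s u → s y ≤ s u → s t ≤ s u)
    (hmeet : ∀ x y, ∃ t, s t ≤ s x ∧ s t ≤ s y ∧ ∀ u, s u ≤ s x → s u ≤ s y → s u ≤ s t) :
    ∃ _ : Lattice α, ∀ x y : α, x ≤ y ↔ s x ≤ s y := by
  choose j hj₁ hj₂ hj₃ using hjoin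
  choose m hm₁ hm₂ hm₃ using hmeet
  let L : Lattice α :=
    { PartialOrder.lift s hs with
      sup := j
      inf := m
      le_sup_left := hj₁
      le_sup_right := hj₂
      sup_le := fun x y u => hj₃ x y u
      inf_le_left := hm₁
      inf_le_right := hm₂
      le_inf := fun u x y => hm₃ x y u }
  exact ⟨L, fun _ _ => Iff.rfl⟩

namespace CentralArrangement

variable {V : Type*} [NormedAddCommGroup V] [InnerProductSpace ℝ V] {A : CentralArrangement V}

/-- The linear form of a hyperplane, scaled so as to be negative at `b`: with this choice, the
region of `b` has the smallest covector. -/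
noncomputable def form (A : CentralArrangement V) (b : V) (H : A.hyperplanes) : V →ₗ[ℝ] ℝ :=
  (-inner ℝ (A.normal H) b) • innerₗ V (A.normal H)

theorem form_apply (b : V) (H : A.hyperplanes) (v : V) :
    A.form b H v = -inner ℝ (A.normal H) b * inner ℝ (A.normal H) v := rfl

theorem inner_normal_ne_zero {b : V} (hb : b ∈ A.complement) (H : A.hyperplanes) :
    inner ℝ (A.normal H) b ≠ 0 :=
  fun h => hb H H.2 ((A.mem_iff H H.2 b).2 h)

theorem form_self_neg {b : V} (hb : b ∈ A.complement) (H : A.hyperplanes) :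
    A.form b H b < 0 := by
  have := mul_self_pos.2 (inner_normal_ne_zero hb H)
  rw [form_apply]; linarith

theorem form_eq_zero_iff {b : V} (hb : b ∈ A.complement) (H : A.hyperplanes) (v : V) :
    A.form b H v = 0 ↔ v ∈ (H : Submodule ℝ V) := by
  rw [form_apply, mul_eq_zero, A.mem_iff H H.2]
  simp [inner_normal_ne_zero hb H]

theorem complement_eq {b : V} (hb : b ∈ A.complement) :
    A.complement = {v | ∀ H, A.form b H v ≠ 0} := by
  ext v
  simp only [complement, Set.mem_ofPred_eq, ne_eq, form_eq_zero_iff hb, Subtype.forall]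

theorem isRegion_iff [FiniteDimensional ℝ V] {b : V} (hb : b ∈ A.complement) {R : Set V} :
    A.IsRegion R ↔ ∃ x, (∀ H, A.form b H x ≠ 0) ∧ R = closedCell (A.form b) x := by
  rw [IsRegion, complement_eq hb]
  refine exists_congr fun x => and_congr_right fun hx => ?_
  rw [closure_connectedComponentIn_eq_closedCell hx]

theorem isFace_iff [FiniteDimensional ℝ V] {b : V} (hb : b ∈ A.complement) {F : Set V} :
    A.IsFace F ↔ ∃ p, F = closedCell (A.form b) p := by
  constructor
  · rintro ⟨S, ⟨R₀, hR₀⟩, hS, rfl⟩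
    have hS' (R) (hR : R ∈ S) := (isRegion_iff hb).1 (hS R hR)
    obtain ⟨p, hp⟩ := exists_closedCell_eq_iInter (f := A.form b)
      (S := {x | (∀ H, A.form b H x ≠ 0) ∧ closedCell (A.form b) x ∈ S}) (by
        obtain ⟨x, hx, rfl⟩ := hS' R₀ hR₀
        exact ⟨x, hx, hR₀⟩) fun x hx => hx.1
    refine ⟨p, ?_⟩
    rw [hp]
    ext v
    simp only [Set.mem_sInter, Set.mem_iInter]
    refine ⟨fun h x hx => h _ hx.2, fun h R hR => ?_⟩
    obtain ⟨x, hx, rfl⟩ := hS' R hR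
    exact h x ⟨hx, hR⟩
  · rintro ⟨p, rfl⟩
    refine ⟨closedCell (A.form b) '' {r | (∀ H, A.form b H r ≠ 0) ∧
      p ∈ closedCell (A.form b) r}, ?_, ?_, ?_⟩
    · obtain ⟨m, hm⟩ := exists_lower_chamber (form_self_neg hb) p
      exact ⟨_, m, ⟨fun i => by have := hm i; grind,
        mem_closedCell_iff.2 fun i => by have := hm i; grind⟩, rfl⟩
    · rintro _ ⟨r, hr, rfl⟩
      exact (isRegion_iff hb).2 ⟨r, hr.1, rfl⟩
    · rw [Set.sInter_image, ← closedCell_eq_iInter (form_self_neg hb)]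

theorem linearIndepOn_form {b : V} (hb : b ∈ A.complement) {S : Set (Submodule ℝ V)}
    (h : LinearIndepOn ℝ A.normal S) :
    LinearIndepOn ℝ (A.form b) {H | (H : Submodule ℝ V) ∈ S} := by
  have h₁ : LinearIndependent ℝ
      fun H : {H : A.hyperplanes | (H : Submodule ℝ V) ∈ S} => A.normal H :=
    LinearIndependent.comp (v := fun H : S => A.normal H) h
      (fun H : {H : A.hyperplanes | (H : Submodule ℝ V) ∈ S} => (⟨H.1.1, H.2⟩ : S))
      fun H H' hH => Subtype.ext (Subtype.ext (Subtype.mk.inj hH))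
  have hker : LinearMap.ker (innerₗ V) = ⊥ := by
    rw [LinearMap.ker_eq_bot']
    exact fun v hv => inner_self_eq_zero.1 (LinearMap.congr_fun hv v)
  exact (h₁.map' (innerₗ V) hker).units_smul
    fun H => Units.mk0 (-inner ℝ (A.normal H) b) (neg_ne_zero.2 (inner_normal_ne_zero hb H))

theorem IsSimplicial.isSimplicialAt [FiniteDimensional ℝ V] (hA : A.IsSimplicial) {b : V}
    (hb : b ∈ A.complement) {r : V} (hr : ∀ H, A.form b H r ≠ 0) :
    IsSimplicialAt (A.form b) r := by
  refine isSimplicialAt_of_linearIndepOn hr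
    ((linearIndepOn_form hb (hA _ ((isRegion_iff hb).2 ⟨r, hr, rfl⟩))).mono fun H hH => ?_)
  have hker : (LinearMap.ker (A.form b H) : Set V) = ((H : Submodule ℝ V) : Set V) := by
    ext v; exact form_eq_zero_iff hb H v
  rw [Set.mem_ofPred_eq, hker] at hH
  exact ⟨H.2, hH⟩

theorem separates_iff {b x : V} (hb : b ∈ A.complement) (H : A.hyperplanes)
    (hx : A.form b H x ≠ 0) :
    A.Separates H (closedCell (A.form b) b) (closedCell (A.form b) x) ↔ 0 < A.form b H x := by
  have hbH := inner_normal_ne_zero hb H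
  constructor
  · intro h
    refine lt_of_le_of_ne ?_ hx.symm
    rw [form_apply]
    rcases h with ⟨h₁, h₂⟩ | ⟨h₁, h₂⟩
    · have := h₁ b (mem_closedCell_self b)
      exact mul_nonneg_of_nonpos_of_nonpos (by linarith) (h₂ x (mem_closedCell_self x))
    · have := h₁ b (mem_closedCell_self b)
      exact mul_nonneg (by linarith) (h₂ x (mem_closedCell_self x))
  · intro h
    have h₁ (v) (hv : v ∈ closedCell (A.form b) b) :
        -inner ℝ (A.normal H) b * inner ℝ (A.normal H) v ≤ 0 :=
      (mem_closedCell_iff.1 hv H).2.2 (form_self_neg hb H)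
    have h₂ (v) (hv : v ∈ closedCell (A.form b) x) :
        0 ≤ -inner ℝ (A.normal H) b * inner ℝ (A.normal H) v :=
      (mem_closedCell_iff.1 hv H).2.1 h
    rcases lt_or_gt_of_ne hbH with hlt | hgt
    · exact Or.inr ⟨fun v hv => nonpos_of_mul_nonpos_right (h₁ v hv) (by linarith),
        fun v hv => nonneg_of_mul_nonneg_right (h₂ v hv) (by linarith)⟩
    · refine Or.inl ⟨fun v hv => ?_, fun v hv => ?_⟩
      · exact nonneg_of_mul_nonneg_right (by linarith [h₁ v hv] :
          0 ≤ inner ℝ (A.normal H) b * inner ℝ (A.normal H) v) hgt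
      · exact nonpos_of_mul_nonpos_right (by linarith [h₂ v hv] :
          inner ℝ (A.normal H) b * inner ℝ (A.normal H) v ≤ 0) hgt

theorem regionLE_iff {b x y : V} (hb : b ∈ A.complement) {B R R' : A.Region}
    (hB : B.carrier = closedCell (A.form b) b) (hx : ∀ H, A.form b H x ≠ 0)
    (hR : R.carrier = closedCell (A.form b) x) (hy : ∀ H, A.form b H y ≠ 0)
    (hR' : R'.carrier = closedCell (A.form b) y) :
    RegionLE B R R' ↔ signVector (A.form b) x ≤ signVector (A.form b) y := by
  rw [signVector_le_iff, RegionLE, hB, hR, hR']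
  constructor
  · intro h H
    have hpos : 0 < A.form b H x → 0 < A.form b H y := fun hH =>
      (separates_iff hb H (hy H)).1 (h ⟨H.2, (separates_iff hb H (hx H)).2 hH⟩).2
    exact ⟨hpos, fun h0 => (hpos (lt_of_le_of_ne h0 (hx H).symm)).le⟩
  · intro h H hH
    exact ⟨hH.1, (separates_iff hb ⟨H, hH.1⟩ (hy _)).2
      ((h _).1 ((separates_iff hb ⟨H, hH.1⟩ (hx _)).1 hH.2))⟩

/-- The facial weak order is the componentwise order of the covectors. -/
theorem facialWeakLE_iff [FiniteDimensional ℝ V] {b p q : V} (hb : b ∈ A.complement)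
    {B : A.Region} {F G : A.Face} (hB : B.carrier = closedCell (A.form b) b)
    (hF : F.carrier = closedCell (A.form b) p) (hG : G.carrier = closedCell (A.form b) q) :
    FacialWeakLE B F G ↔ signVector (A.form b) p ≤ signVector (A.form b) q := by
  have hRegion (R : A.Region) := (isRegion_iff hb).1 R.isRegion
  choose x hx hxR using hRegion
  have hle (R R' : A.Region) : RegionLE B R R' ↔
      signVector (A.form b) (x R) ≤ signVector (A.form b) (x R') :=
    regionLE_iff hb hB (hx R) (hxR R) (hx R') (hxR R')
  -- the ends of the facial interval of the cell of `z`
  have hends (z : V) : ∃ m M : A.Region,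
      (∀ i, (0 < A.form b i z → 0 < A.form b i (x m)) ∧
        (A.form b i z ≤ 0 → A.form b i (x m) < 0)) ∧
      (∀ i, (0 ≤ A.form b i z → 0 < A.form b i (x M)) ∧
        (A.form b i z < 0 → A.form b i (x M) < 0)) := by
    obtain ⟨m, hm⟩ := exists_lower_chamber (form_self_neg hb) z
    obtain ⟨M, hM⟩ := exists_upper_chamber (form_self_neg hb) z
    let m' : A.Region := ⟨_, (isRegion_iff hb).2 ⟨m, fun i => by have := hm i; grind, rfl⟩⟩
    let M' : A.Region := ⟨_, (isRegion_iff hb).2 ⟨M, fun i => by have := hM i; grind, rfl⟩⟩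
    have h₁ := signVector_le_iff.1 (closedCell_eq_iff.1 (hxR m')).le
    have h₂ := signVector_le_iff.1 (closedCell_eq_iff.1 (hxR m')).ge
    have h₃ := signVector_le_iff.1 (closedCell_eq_iff.1 (hxR M')).le
    have h₄ := signVector_le_iff.1 (closedCell_eq_iff.1 (hxR M')).ge
    refine ⟨m', M', fun i => ?_, fun i => ?_⟩
    · have := hm i; have := h₁ i; have := h₂ i; grind
    · have := hM i; have := h₃ i; have := h₄ i; grind
  have hinterval {z : V} {m M : A.Region} {F : A.Face}
      (hF : F.carrier = closedCell (A.form b) z)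
      (hm : ∀ i, (0 < A.form b i z → 0 < A.form b i (x m)) ∧
        (A.form b i z ≤ 0 → A.form b i (x m) < 0))
      (hM : ∀ i, (0 ≤ A.form b i z → 0 < A.form b i (x M)) ∧
        (A.form b i z < 0 → A.form b i (x M) < 0)) : IsFacialInterval B F m M := fun R => by
    rw [hF, hxR R, closedCell_subset_iff, hle, hle]
    exact mem_closedCell_iff_of_chamber hm hM (hx R)
  -- any two facial intervals of a face, being the same set of regions, have equivalent ends
  have hunique {F : A.Face} {m M m' M' : A.Region} (h : IsFacialInterval B F m M)
      (h' : IsFacialInterval B F m' M') (hmM : RegionLE B m M) :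
      RegionLE B m' m ∧ RegionLE B M M' :=
    ⟨((h' m).1 ((h m).2 ⟨subset_rfl, hmM⟩)).1, ((h' M).1 ((h M).2 ⟨hmM, subset_rfl⟩)).2⟩
  have hmM {F : A.Face} {m M m' M' : A.Region} (h : IsFacialInterval B F m M)
      (h' : IsFacialInterval B F m' M') (hmM : RegionLE B m M) : RegionLE B m' M' := by
    obtain ⟨h₁, h₂⟩ := hunique h h' hmM
    exact h₁.trans (hmM.trans h₂)
  obtain ⟨m, M, hm, hM⟩ := hends p
  obtain ⟨m', M', hm', hM'⟩ := hends q
  have hpI := hinterval hF hm hM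
  have hqI := hinterval hG hm' hM'
  have hlt {z : V} {m M : A.Region}
      (hm : ∀ i, (0 < A.form b i z → 0 < A.form b i (x m)) ∧
        (A.form b i z ≤ 0 → A.form b i (x m) < 0))
      (hM : ∀ i, (0 ≤ A.form b i z → 0 < A.form b i (x M)) ∧
        (A.form b i z < 0 → A.form b i (x M) < 0)) : RegionLE B m M := by
    rw [hle, signVector_le_iff]
    intro i; have := hm i; have := hM i; grind
  rw [signVector_le_iff_chambers hm hM hm' hM', ← hle, ← hle]
  refine ⟨?_, fun h => ⟨m, M, m', M', hpI, hqI, h.1, h.2⟩⟩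
  rintro ⟨m₁, M₁, m₂, M₂, hF₁, hG₂, h₁, h₂⟩
  have hF₁' := hmM hpI hF₁ (hlt hm hM)
  have hG₂' := hmM hqI hG₂ (hlt hm' hM')
  exact ⟨(hunique hF₁ hpI hF₁').1.trans (h₁.trans (hunique hqI hG₂ (hlt hm' hM')).1),
    (hunique hpI hF₁ (hlt hm hM)).2.trans (h₂.trans (hunique hG₂ hqI hG₂').2)⟩

end CentralArrangement

theorem mainTheorem8 {V : Type*} [NormedAddCommGroup V] [InnerProductSpace ℝ V]
    [FiniteDimensional ℝ V] (A : CentralArrangement V) (hA : A.IsSimplicial) (B : A.Region) :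
    ∃ (_ : Lattice A.Region) (_ : Lattice A.Face),
      (∀ R R' : A.Region, R ≤ R' ↔ CentralArrangement.RegionLE B R R') ∧
      (∀ F G : A.Face, F ≤ G ↔ CentralArrangement.FacialWeakLE B F G) ∧
      (∀ R R' : A.Region, R.toFace ≤ R'.toFace ↔ R ≤ R') ∧
      IsSublattice (Set.range fun R : A.Region => R.toFace) ∧
      (∀ R R' : A.Region, R.toFace ⊔ R'.toFace = (R ⊔ R').toFace) ∧
      (∀ R R' : A.Region, R.toFace ⊓ R'.toFace = (R ⊓ R').toFace) := by
  obtain ⟨b, hb, hB⟩ := B.isRegion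
  have hneg := CentralArrangement.form_self_neg hb
  have hs (r) (hr : ∀ H, A.form b H r ≠ 0) := hA.isSimplicialAt hb hr
  replace hB : B.carrier = closedCell (A.form b) b := by
    rw [hB, CentralArrangement.complement_eq hb,
      closure_connectedComponentIn_eq_closedCell fun H => (hneg H).ne]
  have hRegion (R : A.Region) := (CentralArrangement.isRegion_iff hb).1 R.isRegion
  have hFace (F : A.Face) := (CentralArrangement.isFace_iff hb).1 F.isFace
  choose x hx hxR using hRegion
  choose p hp using hFace
  have hface (z : V) : ∃ F : A.Face, signVector (A.form b) (p F) = signVector (A.form b) z := by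
    let F : A.Face := ⟨_, (CentralArrangement.isFace_iff hb).2 ⟨z, rfl⟩⟩
    exact ⟨F, closedCell_eq_iff.1 (hp F).symm⟩
  have hregion (z : V) (hz : ∀ H, A.form b H z ≠ 0) :
      ∃ R : A.Region, signVector (A.form b) (x R) = signVector (A.form b) z := by
    let R : A.Region := ⟨_, (CentralArrangement.isRegion_iff hb).2 ⟨z, hz, rfl⟩⟩
    exact ⟨R, closedCell_eq_iff.1 (hxR R).symm⟩
  have hpx (R : A.Region) :
      signVector (A.form b) (p R.toFace) = signVector (A.form b) (x R) :=
    closedCell_eq_iff.1 ((hp R.toFace).symm.trans (hxR R))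
  -- the ends of facial intervals, as adjoints of the embedding of the regions into the faces
  have hlow (z : V) : ∃ m : A.Region, signVector (A.form b) (x m) ≤ signVector (A.form b) z ∧
      ∀ R : A.Region, signVector (A.form b) (x R) ≤ signVector (A.form b) z →
        signVector (A.form b) (x R) ≤ signVector (A.form b) (x m) := by
    obtain ⟨r, hr⟩ := exists_lower_chamber hneg z
    obtain ⟨m, hm⟩ := hregion r fun H => by have := hr H; grind
    refine ⟨m, hm ▸ signVector_le_iff.2 fun H => ?_,
      fun R hR => hm ▸ signVector_le_iff.2 fun H => ?_⟩
    · have := hr H; grind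
    · have := hr H; have := signVector_le_iff.1 hR H; have := hx R H; grind
  have hupp (z : V) : ∃ M : A.Region, signVector (A.form b) z ≤ signVector (A.form b) (x M) ∧
      ∀ R : A.Region, signVector (A.form b) z ≤ signVector (A.form b) (x R) →
        signVector (A.form b) (x M) ≤ signVector (A.form b) (x R) := by
    obtain ⟨r, hr⟩ := exists_upper_chamber hneg z
    obtain ⟨M, hM⟩ := hregion r fun H => by have := hr H; grind
    refine ⟨M, hM ▸ signVector_le_iff.2 fun H => ?_,
      fun R hR => hM ▸ signVector_le_iff.2 fun H => ?_⟩
    · have := hr H; grind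
    · have := hr H; have := signVector_le_iff.1 hR H; have := hx R H; grind
  obtain ⟨LF, hLF⟩ := exists_lattice_of_join_meet
    (s := fun F : A.Face => signVector (A.form b) (p F))
    (by
      rintro ⟨F, hF⟩ ⟨G, hG⟩ h
      have := (hp ⟨F, hF⟩).trans ((closedCell_eq_iff.2 h).trans (hp ⟨G, hG⟩).symm)
      simpa using this)
    (fun F G => by
      obtain ⟨t, h₁, h₂, h₃⟩ := exists_join hneg hs (p F) (p G)
      obtain ⟨T, hT⟩ := hface t
      exact ⟨T, by rwa [hT], by rwa [hT], fun U hU hU' => by rw [hT]; exact h₃ _ hU hU'⟩)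
    (fun F G => by
      obtain ⟨t, h₁, h₂, h₃⟩ := exists_meet hneg hs (p F) (p G)
      obtain ⟨T, hT⟩ := hface t
      exact ⟨T, by rwa [hT], by rwa [hT], fun U hU hU' => by rw [hT]; exact h₃ _ hU hU'⟩)
  obtain ⟨LR, hLR⟩ := exists_lattice_of_join_meet
    (s := fun R : A.Region => signVector (A.form b) (x R))
    (by
      rintro ⟨F, hF⟩ ⟨G, hG⟩ h
      have := (hxR ⟨F, hF⟩).trans ((closedCell_eq_iff.2 h).trans (hxR ⟨G, hG⟩).symm)
      simpa using this)
    (fun R R' => by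
      obtain ⟨t, h₁, h₂, h₃⟩ := exists_join hneg hs (x R) (x R')
      obtain ⟨m, hm, hm'⟩ := hlow t
      exact ⟨m, hm' R h₁, hm' R' h₂, fun U hU hU' => hm.trans (h₃ _ hU hU')⟩)
    (fun R R' => by
      obtain ⟨t, h₁, h₂, h₃⟩ := exists_meet hneg hs (x R) (x R')
      obtain ⟨M, hM, hM'⟩ := hupp t
      exact ⟨M, hM' R h₁, hM' R' h₂, fun U hU hU' => (h₃ _ hU hU').trans hM⟩)
  have hle (R R' : A.Region) : R.toFace ≤ R'.toFace ↔ R ≤ R' := by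
    rw [hLF, hLR, hpx, hpx]
  have hsup (R R' : A.Region) : R.toFace ⊔ R'.toFace = (R ⊔ R').toFace := by
    refine le_antisymm (sup_le ((hle _ _).2 le_sup_left) ((hle _ _).2 le_sup_right)) ?_
    obtain ⟨m, hm, hm'⟩ := hlow (p (R.toFace ⊔ R'.toFace))
    have hmF : m.toFace ≤ R.toFace ⊔ R'.toFace := by rwa [hLF, hpx]
    refine ((hle _ _).2 (sup_le ((hLR _ _).2 (hm' R ?_)) ((hLR _ _).2 (hm' R' ?_)))).trans hmF
    · rw [← hpx, ← hLF]; exact le_sup_left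
    · rw [← hpx, ← hLF]; exact le_sup_right
  have hinf (R R' : A.Region) : R.toFace ⊓ R'.toFace = (R ⊓ R').toFace := by
    refine le_antisymm ?_ (le_inf ((hle _ _).2 inf_le_left) ((hle _ _).2 inf_le_right))
    obtain ⟨M, hM, hM'⟩ := hupp (p (R.toFace ⊓ R'.toFace))
    have hMF : R.toFace ⊓ R'.toFace ≤ M.toFace := by rwa [hLF, hpx]
    refine hMF.trans ((hle _ _).2 (le_inf ((hLR _ _).2 (hM' R ?_)) ((hLR _ _).2 (hM' R' ?_))))
    · rw [← hpx, ← hLF]; exact inf_le_left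
    · rw [← hpx, ← hLF]; exact inf_le_right
  refine ⟨LR, LF, fun R R' => ?_, fun F G => ?_, hle, ⟨?_, ?_⟩, hsup, hinf⟩
  · rw [hLR, CentralArrangement.regionLE_iff hb hB (hx R) (hxR R) (hx R') (hxR R')]
  · rw [hLF, CentralArrangement.facialWeakLE_iff hb hB (hp F) (hp G)]
  · rintro _ ⟨R, rfl⟩ _ ⟨R', rfl⟩
    exact ⟨R ⊔ R', (hsup R R').symm⟩
  · rintro _ ⟨R, rfl⟩ _ ⟨R', rfl⟩
    exact ⟨R ⊓ R', (hinf R R').symm⟩
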